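/- Let $n\ge 3$ and let $(s_j)_{j\ge 0}$ be a binary m-sequence of order $n$, that is, a sequence in $\mathbb F_2$, not identically zero, satisfying $s_{j+n}=c_{n-1}s_{j+n-1}+\dots+c_1s_{j+1}+c_0s_j$ for all $j\ge 0$, where $c_0,\dots,c_{n-1}\in\mathbb F_2$ are such that $x^n+c_{n-1}x^{n-1}+\dots+c_1x+c_0\in\mathbb F_2[x]$ is a primitive polynomial of degree $n$ (the minimal polynomial over $\mathbb F_2$ of a generator of $\mathbb F_{2^n}^*$). For $1\le t\le 2^n-1$ let $G_t\in\mathbb F_2^{n\times t}$ be the observability matrix, whose $(i,j)$ entry is $s_{i+j-2}$ for $1\le i\le n$, $1\le j\le t$, and let $r_n(t)=\operatorname{rank}(G_tG_t^{\top})$, the rank over $\mathbb F_2$. Regard the argument $t$ of $r_n$ modulo $2^n-1$, with representatives $1,\dots,2^n-1$. If $r_n(t-1)=n-1$ and $r_n(t)=n$, then $r_n(t+1)=n$. -/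

import Mathlib

/-- `α` is a primitive element of the field `𝔽_{2^n}`: it generates the multiplicative group. -/
def IsPrimitiveElt (n : ℕ) (α : (GaloisField 2 n)ˣ) : Prop :=
  ∀ x : (GaloisField 2 n)ˣ, x ∈ Subgroup.zpowers α

/-- `f ∈ 𝔽₂[x]` is a primitive polynomial of degree `n`: it is the minimal polynomial over `𝔽₂`
of a primitive element of `𝔽_{2^n}`. -/
def IsPrimitivePoly (n : ℕ) (f : Polynomial (ZMod 2)) : Prop :=
  ∃ α : (GaloisField 2 n)ˣ, IsPrimitiveElt n α ∧ f = minpoly (ZMod 2) (α : GaloisField 2 n)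

/-- `s` is a binary m-sequence of order `n`: a sequence over `𝔽₂`, not identically zero, with
`s_{t+n} = c_{n-1} s_{t+n-1} + ⋯ + c_0 s_t` for all `t`, where the characteristic polynomial
`x^n + c_{n-1} x^{n-1} + ⋯ + c_0` is primitive of degree `n`. (`LinearRecurrence.charPoly` is
`x^n - ∑ c_i x^i`, which is the same polynomial over `𝔽₂`.) -/
def IsMSequence (n : ℕ) (s : ℕ → ZMod 2) : Prop :=
  (∃ t, s t ≠ 0) ∧
    ∃ c : Fin n → ZMod 2,
      (LinearRecurrence.mk n c).IsSolution s ∧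
        IsPrimitivePoly n (LinearRecurrence.mk n c).charPoly

/-- The observability matrix `G_t`: the `n × t` matrix whose `(i, j)` entry (indices from `0`) is
`s_{i+j}`. -/
def obsMatrix (n : ℕ) (s : ℕ → ZMod 2) (t : ℕ) : Matrix (Fin n) (Fin t) (ZMod 2) :=
  Matrix.of fun i j => s (i + j)

/-- The rank over `𝔽₂` of the Gram matrix `G_t G_tᵀ`. -/
noncomputable def gramRank (n : ℕ) (s : ℕ → ZMod 2) (t : ℕ) : ℕ :=
  (obsMatrix n s t * (obsMatrix n s t).transpose).rank

/-- The rank function `r_n` with its argument regarded modulo `2^n - 1`. The value at a residue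
class `t` is taken at the representative `(t - 1).val + 1` of `t` in `{1, …, 2^n - 1}`. -/
noncomputable def cyclicGramRank (n : ℕ) (s : ℕ → ZMod 2) (t : ZMod (2 ^ n - 1)) : ℕ :=
  gramRank n s ((t - 1).val + 1)

/-! Let `M` be the regular Gram matrix of the windows `g 0, …, g t`, and solve `M w = ∑ g j`. Since
`a * a = a` in 𝔽₂, `xᵀ M x = x ⬝ ∑ g j = xᵀ M w`. Hence any rank-one update by `v` that makes `M`
singular forces `v ⬝ w = 1` (`dotProduct_eq_one`). The singular predecessor, transported by the
transition matrix `A`, is the update by `g 0`. If the successor is singular too, it is the update by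
`g (t + 1)`; at the end of a period these two windows coincide. With value 1 at both ends, shifting
the sum shows `Aᵀ w = w`, so `w` is constantly 1 along the windows. Then the constant sequence 1
solves the recurrence, and 1 is a root of an irreducible polynomial of degree at least 2, a
contradiction. -/

open Matrix Finset in
/-- The sum of the outer products `g j (g j)ᵀ` over `j < t`. -/
def gramSum {ι : Type*} (g : ℕ → ι → ZMod 2) (t : ℕ) : Matrix ι ι (ZMod 2) :=
  ∑ j ∈ range t, vecMulVec (g j) (g j)

namespace gramSum

open Matrix Finset

variable {ι : Type*} (g : ℕ → ι → ZMod 2)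

theorem succ (t : ℕ) : gramSum g (t + 1) = gramSum g t + vecMulVec (g t) (g t) :=
  sum_range_succ _ _

variable [Fintype ι]

theorem mulVec_eq (t : ℕ) (x : ι → ZMod 2) :
    gramSum g t *ᵥ x = ∑ j ∈ range t, (g j ⬝ᵥ x) • g j := by
  simp [gramSum, sum_mulVec, vecMulVec_mulVec]

/-- Conjugation by `A` shifts the windows; only the initial one must be put back. This turns a
statement about dropping the last window into one about dropping the first. -/
theorem mul_transpose (t : ℕ) {A : Matrix ι ι (ZMod 2)} (hA : ∀ j, A *ᵥ g j = g (j + 1)) :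
    A * gramSum g t * Aᵀ + vecMulVec (g 0) (g 0) = gramSum g (t + 1) := by
  simp only [gramSum, Finset.mul_sum, Finset.sum_mul, mul_vecMulVec, vecMulVec_mul,
    vecMul_transpose, hA]
  rw [sum_range_succ']

/-- Over `𝔽₂` the quadratic form of a Gram matrix is linear. -/
theorem dotProduct_mulVec_self (t : ℕ) (x : ι → ZMod 2) :
    x ⬝ᵥ gramSum g t *ᵥ x = (∑ j ∈ range t, g j) ⬝ᵥ x := by
  have key : ∀ a : ZMod 2, a * a = a := by decide
  simp only [mulVec_eq, dotProduct_sum, sum_dotProduct, dotProduct_smul, smul_eq_mul]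
  refine sum_congr rfl fun j _ => ?_
  rw [dotProduct_comm x, key]

theorem dotProduct_comm_mulVec (t : ℕ) (x y : ι → ZMod 2) :
    x ⬝ᵥ gramSum g t *ᵥ y = y ⬝ᵥ gramSum g t *ᵥ x := by
  simp only [mulVec_eq, dotProduct_sum, dotProduct_smul, smul_eq_mul]
  refine sum_congr rfl fun j _ => ?_
  rw [dotProduct_comm x, dotProduct_comm y, mul_comm]

variable [DecidableEq ι]

/-- If a rank-one update by `v` makes an invertible Gram matrix singular, then the solution of
`M w = ∑ g j` satisfies `v ⬝ w = 1`. -/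
theorem dotProduct_eq_one {t : ℕ} {v w : ι → ZMod 2} (hM : (gramSum g t).det ≠ 0)
    (hv : (gramSum g t + vecMulVec v v).det = 0)
    (hw : gramSum g t *ᵥ w = ∑ j ∈ range t, g j) : v ⬝ᵥ w = 1 := by
  have two : ∀ a : ZMod 2, a = 0 ∨ a = 1 := by decide
  obtain ⟨x, hx0, hx⟩ := exists_mulVec_eq_zero_iff.mpr hv
  rw [add_mulVec, vecMulVec_mulVec, op_smul_eq_smul] at hx
  rcases two (v ⬝ᵥ x) with h | h
  · rw [h, zero_smul, add_zero] at hx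
    exact absurd (exists_mulVec_eq_zero_iff.mp ⟨x, hx0, hx⟩) hM
  · rw [h, one_smul] at hx
    have hxv : gramSum g t *ᵥ x = v := by
      rw [eq_neg_of_add_eq_zero_left hx]
      exact funext fun i => ZMod.neg_eq_self_mod_two _
    -- With `v = M x`: `v ⬝ w = xᵀ M w = x ⬝ ∑ g j = xᵀ M x = x ⬝ v = 1`.
    rw [dotProduct_comm, ← hxv, dotProduct_comm_mulVec, hw, dotProduct_comm,
      ← dotProduct_mulVec_self, hxv, dotProduct_comm, h]

variable {g} {A : Matrix ι ι (ZMod 2)}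

theorem pow_mulVec (hA : ∀ j, A *ᵥ g j = g (j + 1)) (k j : ℕ) : A ^ k *ᵥ g j = g (j + k) := by
  induction k with
  | zero => simp
  | succ k ih => rw [pow_succ', ← mulVec_mulVec, ih, hA]; rfl

theorem mulVec_injective_of_det_ne_zero {t : ℕ} (hM : (gramSum g t).det ≠ 0) :
    Function.Injective (gramSum g t).mulVec :=
  mulVec_injective_iff_isUnit.mpr ((isUnit_iff_isUnit_det _).mpr hM.isUnit)

/-- The transition matrix of a periodic sequence that spans the space is injective. -/
theorem transition_injective (hA : ∀ j, A *ᵥ g j = g (j + 1)) {N t : ℕ} (hN : 0 < N)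
    (hg : ∀ j, g (j + N) = g j) (hM : (gramSum g t).det ≠ 0) :
    Function.Injective A.mulVec := by
  -- `A ^ N` fixes every window, hence `M`; cancelling the regular `M` gives `A ^ N = 1`.
  have hpow : A ^ N * gramSum g t = gramSum g t := by
    simp only [gramSum, Finset.mul_sum, mul_vecMulVec, pow_mulVec hA, hg]
  have hAN : A ^ N = 1 := by
    have hu : IsUnit (gramSum g t) := (isUnit_iff_isUnit_det _).mpr hM.isUnit
    exact hu.mul_right_cancel (by rw [hpow, one_mul])
  refine mulVec_injective_iff_isUnit.mpr ?_
  exact IsUnit.of_pow_eq_one hAN hN.ne'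

/-- The solution of `M w = ∑ g j` is fixed by the transposed transition matrix as soon as it
takes the value `1` at both ends. -/
theorem transpose_mulVec_eq_self (hA : ∀ j, A *ᵥ g j = g (j + 1))
    (hinj : Function.Injective A.mulVec) {t : ℕ} {w : ι → ZMod 2}
    (hM : (gramSum g t).det ≠ 0) (hw : gramSum g t *ᵥ w = ∑ j ∈ range t, g j)
    (h0 : g 0 ⬝ᵥ w = 1) (ht : g t ⬝ᵥ w = 1) : Aᵀ *ᵥ w = w := by
  apply mulVec_injective_of_det_ne_zero hM
  apply hinj
  have hy : ∀ j, g j ⬝ᵥ Aᵀ *ᵥ w = g (j + 1) ⬝ᵥ w := fun j => by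
    rw [dotProduct_mulVec, vecMul_transpose, hA]
  -- Both `∑ (g j ⬝ w) g j` and `∑ g j` are split at either end. Their end terms agree, so `A M Aᵀ w
  -- = ∑ g (j + 1) = A M w`.
  have e := (sum_range_succ (fun j => (g j ⬝ᵥ w) • g j) t).symm.trans (sum_range_succ' _ t)
  have e' := (sum_range_succ g t).symm.trans (sum_range_succ' _ t)
  rw [← mulVec_eq, hw, h0, ht, one_smul, one_smul, e', add_left_inj] at e
  simp only [hw, mulVec_eq g t (Aᵀ *ᵥ w), hy, mulVec_sum, mulVec_smul, hA, ← e]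

/-- If the Gram matrix at `t + 1` is regular, the one at `t` is singular, and either the one at
`t + 2` is singular or `t + 1` closes a period, then a linear functional is constantly `1` along
the sequence. -/
theorem exists_dotProduct_eq_one (hA : ∀ j, A *ᵥ g j = g (j + 1)) {N t : ℕ} (hN : 0 < N)
    (hg : ∀ j, g (j + N) = g j) (hprev : (gramSum g t).det = 0)
    (hM : (gramSum g (t + 1)).det ≠ 0)
    (hnext : (gramSum g (t + 2)).det = 0 ∨ g (t + 1) = g 0) :
    ∃ w, ∀ j, g j ⬝ᵥ w = 1 := by
  obtain ⟨w, hw⟩ := mulVec_surjective_iff_isUnit.mpr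
    ((isUnit_iff_isUnit_det _).mpr hM.isUnit) (∑ j ∈ range (t + 1), g j)
  have h0 : g 0 ⬝ᵥ w = 1 := by
    refine dotProduct_eq_one g hM ?_ hw
    -- In characteristic 2, adding the outer product of `g 0` removes it, leaving `A M Aᵀ` for the
    -- singular `M` at `t`.
    have h2 : vecMulVec (g 0) (g 0) + vecMulVec (g 0) (g 0) = 0 :=
      Matrix.ext fun _ _ => CharTwo.add_self_eq_zero _
    rw [← mul_transpose g t hA, add_assoc, h2, add_zero, det_mul, det_mul, hprev]
    simp
  have ht : g (t + 1) ⬝ᵥ w = 1 := by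
    rcases hnext with h | h
    · exact dotProduct_eq_one g hM (by rwa [← succ]) hw
    · rwa [h]
  have hfix := transpose_mulVec_eq_self hA (transition_injective hA hN hg hM) hM hw h0 ht
  refine ⟨w, fun j => ?_⟩
  induction j with
  | zero => exact h0
  | succ j ih => rw [← hA, ← vecMul_transpose, ← dotProduct_mulVec, hfix, ih]

theorem rank_eq_card_iff (M : Matrix ι ι (ZMod 2)) : M.rank = Fintype.card ι ↔ M.det ≠ 0 := by
  rw [← isUnit_iff_ne_zero, ← isUnit_iff_isUnit_det]
  refine ⟨fun h => ?_, rank_of_isUnit M⟩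
  rw [← mulVec_surjective_iff_isUnit]
  have : LinearMap.range M.mulVecLin = ⊤ :=
    Submodule.eq_top_of_finrank_eq (by rw [Module.finrank_fintype_fun_eq_card]; exact h)
  exact LinearMap.range_eq_top.mp this

end gramSum

namespace LinearRecurrence

open Polynomial

variable {R : Type*} [CommRing R] (E : LinearRecurrence R)

theorem tupleSucc_window {u : ℕ → R} (hu : E.IsSolution u) (j : ℕ) :
    E.tupleSucc (fun i => u (i + j)) = fun i : Fin E.order => u (i + (j + 1)) := by
  funext i
  simp only [tupleSucc, LinearMap.coe_mk, AddHom.coe_mk]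
  split_ifs with h
  · congr 1; ring
  · have hi : (i : ℕ) + (j + 1) = j + E.order := by have := i.2; lia
    rw [hi, hu j]
    simp only [add_comm]

/-- The shift of sequences. -/
def shift (R : Type*) [CommRing R] : (ℕ → R) →ₗ[R] (ℕ → R) :=
  LinearMap.funLeft R R (· + 1)

theorem shift_pow_apply (k : ℕ) (u : ℕ → R) (j : ℕ) : (shift R ^ k) u j = u (j + k) := by
  induction k generalizing j with
  | zero => rfl
  | succ k ih =>
    rw [pow_succ', Module.End.mul_apply]
    change (shift R ^ k) u (j + 1) = _
    rw [ih]; congr 1; ring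

/-- The recurrence says that the characteristic polynomial, evaluated at the shift, kills `u`;
divisibility of polynomials then yields periods. -/
theorem aeval_shift_charPoly {u : ℕ → R} (hu : E.IsSolution u) :
    aeval (shift R) E.charPoly u = 0 := by
  funext j
  simp [charPoly, aeval_monomial, shift_pow_apply, hu j]

/-- If the characteristic polynomial divides `X ^ N - 1`, every solution has period `N`. -/
theorem IsSolution.periodic {E : LinearRecurrence R} {u : ℕ → R} (hu : E.IsSolution u) {N : ℕ}
    (hN : E.charPoly ∣ X ^ N - 1) (j : ℕ) : u (j + N) = u j := by
  obtain ⟨q, hq⟩ := hN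
  have h : aeval (shift R) (X ^ N - 1 : R[X]) u = 0 := by
    rw [hq, mul_comm, map_mul, Module.End.mul_apply, E.aeval_shift_charPoly hu, map_zero]
  have := congrFun h j
  simpa [shift_pow_apply, sub_eq_zero] using this

/-- A linear combination of the windows of a solution is a solution. -/
theorem IsSolution.dotProduct_window {E : LinearRecurrence R} {u : ℕ → R} (hu : E.IsSolution u)
    {m : ℕ} (w : Fin m → R) :
    E.IsSolution fun j => (fun i : Fin m => u (i + j)) ⬝ᵥ w := by
  intro j
  simp only [dotProduct, Finset.mul_sum]
  rw [Finset.sum_comm]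
  refine Finset.sum_congr rfl fun i _ => ?_
  rw [← add_assoc, hu, Finset.sum_mul]
  simp only [add_assoc, mul_assoc]

end LinearRecurrence

theorem gramRank_eq_rank_gramSum (n : ℕ) (s : ℕ → ZMod 2) (t : ℕ) :
    gramRank n s t = (gramSum (fun j (i : Fin n) => s (i + j)) t).rank := by
  unfold gramRank
  congr 1
  ext i k
  simp [gramSum, obsMatrix, Matrix.mul_apply, Matrix.sum_apply, Matrix.vecMulVec_apply,
    Finset.sum_range]

theorem IsPrimitivePoly.dvd_X_pow_sub_one {n : ℕ} (hn : n ≠ 0) {f : Polynomial (ZMod 2)}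
    (hf : IsPrimitivePoly n f) : f ∣ Polynomial.X ^ (2 ^ n - 1) - 1 := by
  obtain ⟨α, -, rfl⟩ := hf
  have := Fintype.ofFinite (GaloisField 2 n)
  have hcard : Fintype.card (GaloisField 2 n) = 2 ^ n := by
    rw [← Nat.card_eq_fintype_card, GaloisField.card 2 n hn]
  refine minpoly.dvd _ _ ?_
  have := FiniteField.pow_card_sub_one_eq_one (α : GaloisField 2 n) α.ne_zero
  rw [hcard] at this
  simp [this]

theorem IsPrimitivePoly.irreducible {n : ℕ} {f : Polynomial (ZMod 2)}
    (hf : IsPrimitivePoly n f) : Irreducible f := by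
  obtain ⟨α, -, rfl⟩ := hf
  exact minpoly.irreducible (Algebra.IsIntegral.isIntegral _)

open Matrix in
/-- A regular Gram matrix of an m-sequence following a singular one is followed by a regular one,
and does not occur at the end of a period. -/
theorem IsMSequence.gramRank_add_two {n : ℕ} (hn : 2 ≤ n) {s : ℕ → ZMod 2}
    (hs : IsMSequence n s) {t : ℕ} (h₁ : gramRank n s t ≠ n) (h₂ : gramRank n s (t + 1) = n) :
    gramRank n s (t + 2) = n ∧ t + 1 ≠ 2 ^ n - 1 := by
  obtain ⟨-, c, hsol, hprim⟩ := hs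
  set E := LinearRecurrence.mk n c
  set g : ℕ → Fin n → ZMod 2 := fun j i => s (i + j) with hgdef
  have hrank : ∀ k, gramRank n s k = n ↔ (gramSum g k).det ≠ 0 := fun k => by
    rw [gramRank_eq_rank_gramSum, ← gramSum.rank_eq_card_iff, Fintype.card_fin]
  have hper : ∀ j, s (j + (2 ^ n - 1)) = s j :=
    hsol.periodic (hprim.dvd_X_pow_sub_one (by lia))
  have hg : ∀ j, g (j + (2 ^ n - 1)) = g j := fun j => funext fun i => by
    simp only [hgdef, ← add_assoc, hper]
  have hN : 0 < 2 ^ n - 1 := by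
    have := Nat.one_lt_two_pow (n := n) (by lia)
    lia
  let T : (Fin n → ZMod 2) →ₗ[ZMod 2] (Fin n → ZMod 2) := E.tupleSucc
  have hA : ∀ j, LinearMap.toMatrix' T *ᵥ g j = g (j + 1) := fun j => by
    rw [LinearMap.toMatrix'_mulVec]
    exact E.tupleSucc_window hsol j
  rw [Ne, hrank, not_not] at h₁
  rw [hrank] at h₂
  rw [hrank, ← not_or]
  intro hnext
  obtain ⟨w, hw⟩ := gramSum.exists_dotProduct_eq_one hA hN hg h₁ h₂
    (hnext.imp_right fun h => by rw [h]; simpa using hg 0)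
  -- The constant 1 is written as a geometric sequence of ratio 1, so that being a solution means
  -- that 1 is a root.
  have hconst : E.IsSolution fun j => 1 ^ j := by
    have := hsol.dotProduct_window w
    simp only [one_pow]
    exact (funext hw : (fun j => g j ⬝ᵥ w) = fun _ => 1) ▸ this
  have hdeg := Polynomial.degree_eq_one_of_irreducible_of_root hprim.irreducible
    ((E.geom_sol_iff_root_charPoly 1).mp hconst)
  rw [E.charPoly_degree_eq_order] at hdeg
  have : n = 1 := by exact_mod_cast hdeg
  lia

theorem gramRank_le (n : ℕ) (s : ℕ → ZMod 2) (t : ℕ) : gramRank n s t ≤ t :=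
  (Matrix.rank_mul_le_left _ _).trans (Matrix.rank_le_width _)

theorem cyclicGramRank_natCast_succ (n : ℕ) (s : ℕ → ZMod 2) {k : ℕ} (hk : k < 2 ^ n - 1) :
    cyclicGramRank n s ((k + 1 : ℕ) : ZMod (2 ^ n - 1)) = gramRank n s (k + 1) := by
  unfold cyclicGramRank
  rw [Nat.cast_succ, add_sub_cancel_right, ZMod.val_natCast_of_lt hk]

theorem theorem2 (n : ℕ) (hn : 3 ≤ n) (s : ℕ → ZMod 2) (hs : IsMSequence n s)
    (t : ZMod (2 ^ n - 1))
    (h₁ : cyclicGramRank n s (t - 1) = n - 1) (h₂ : cyclicGramRank n s t = n) :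
    cyclicGramRank n s (t + 1) = n := by
  have hN : 0 < 2 ^ n - 1 := by
    have := Nat.one_lt_two_pow (n := n) (by lia)
    lia
  have : NeZero (2 ^ n - 1) := ⟨hN.ne'⟩
  obtain ⟨k, hk, rfl⟩ : ∃ k < 2 ^ n - 1, t = ((k + 1 : ℕ) : ZMod (2 ^ n - 1)) :=
    ⟨(t - 1).val, ZMod.val_lt _, by simp⟩
  rw [cyclicGramRank_natCast_succ n s hk] at h₂
  -- A single window gives rank at most 1 < n, so `t - 1` does not wrap around.
  obtain ⟨k, rfl⟩ : ∃ m, k = m + 1 := Nat.exists_eq_add_one_of_ne_zero fun h => by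
    have := gramRank_le n s (k + 1)
    lia
  rw [Nat.cast_succ (k + 1), add_sub_cancel_right,
    cyclicGramRank_natCast_succ n s (by lia)] at h₁
  -- `hne` excludes the end of the period, so `t + 1` does not wrap around either.
  obtain ⟨h, hne⟩ := hs.gramRank_add_two (by lia) (by lia) h₂
  rw [← Nat.cast_succ, cyclicGramRank_natCast_succ n s (by lia)]
  exact h
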